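/- Let $M$ be a smooth $n$-manifold and $E = TM\oplus T^*M$ with the pairing $\langle X+\xi, Y+\eta\rangle = \eta(X)+\xi(Y)$, the Dorfman bracket $[X+\xi,Y+\eta]_D=[X,Y]+\mathcal L_X\eta-\iota_Y d\xi$ and the Courant bracket $[e_1,e_2]_C=\tfrac12([e_1,e_2]_D-[e_2,e_1]_D)$. A generalized metric is a smooth rank-$n$ subbundle $V\subset E$ on which the pairing is positive definite. Put $V^+=V$, $V^-=V^\perp$, so that $E=V^+\oplus V^-$; let $e\mapsto e_+$ be the projection onto $V^+$ along $V^-$, let $\pi:E\to TM$ be the projection on the first summand, and for a vector field $X$ let $X^\pm$ be the unique section of $V^\pm$ with $\pi(X^\pm)=X$. The affine connection on $M$ induced by $V^+$ is $$\nabla^+_XY=\pi\big(([X^-,Y^+]_C)_+\big).$$ Let $g$ be a Riemannian metric, $b$ a smooth $2$-form and $\alpha$ a smooth $1$-form on $M$. Let $$V^+=\{X+gX+bX\},\qquad V^+_{d\alpha}=\{X+gX+bX+d\alpha X\}\qquad (X\in TM)$$ be two generalized metrics that differ by an exact term, where $gX=g(X,\cdot)$, $bX=\iota_Xb$ and $d\alpha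 X=\iota_X d\alpha$. Then the induced connections coincide: $\nabla^+_XY=\nabla^{+,d\alpha}_XY$ for all smooth vector fields $X,Y$ on $M$. -/

import Mathlib

open Set
open scoped Manifold ContDiff Topology Bundle

noncomputable section

namespace GeneralizedGeometry

/-- The model space `ℝⁿ`. -/
abbrev Model (n : ℕ) : Type := EuclideanSpace ℝ (Fin n)

section Objects

variable (n : ℕ) {M : Type*} [TopologicalSpace M] [ChartedSpace (Model n) M]

/-- The tangent space `T_x M`. -/
abbrev Tangent (x : M) : Type := TangentSpace (𝓡 n) x

/-- The cotangent space `T*_x M`. -/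
abbrev Cotangent (x : M) : Type := TangentSpace (𝓡 n) x →L[ℝ] ℝ

/-- The fibre `E_x = T_x M ⊕ T*_x M` of the generalized tangent bundle; `X + ξ` is `(X, ξ)`. -/
abbrev GTangent (x : M) : Type := Tangent n x × Cotangent n x

end Objects

section Sections

variable {n : ℕ} {M : Type*} [TopologicalSpace M] [ChartedSpace (Model n) M]
  [IsManifold (𝓡 n) ∞ M]

/-- Smoothness on a set `U` of a section of `TM`. -/
def SmoothVectorOn (X : ∀ x : M, Tangent n x) (U : Set M) : Prop :=
  ContMDiffOn (𝓡 n) ((𝓡 n).prod 𝓘(ℝ, Model n)) ∞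
    (fun x ↦ Bundle.TotalSpace.mk' (Model n) (E := fun x : M ↦ TangentSpace (𝓡 n) x) x (X x)) U

/-- Smoothness on a set `U` of a section of `T*M`. -/
def SmoothCovectorOn (ξ : ∀ x : M, Cotangent n x) (U : Set M) : Prop :=
  ContMDiffOn (𝓡 n) ((𝓡 n).prod 𝓘(ℝ, Model n →L[ℝ] ℝ)) ∞
    (fun x ↦ Bundle.TotalSpace.mk' (Model n →L[ℝ] ℝ)
      (E := fun x : M ↦ (TangentSpace (𝓡 n) x →L[ℝ] ℝ)) x (ξ x)) U

end Sections

section Forms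

variable (n : ℕ) (M : Type*) [TopologicalSpace M] [ChartedSpace (Model n) M]
  [IsManifold (𝓡 n) ∞ M]

/-- Smooth vector fields on `M`. -/
structure SmoothField where
  toFun : ∀ x : M, Tangent n x
  smooth : SmoothVectorOn toFun univ

/-- Smooth `1`-forms on `M`. -/
structure OneForm where
  toFun : ∀ x : M, Cotangent n x
  smooth : SmoothCovectorOn toFun univ

/-- Smooth `2`-forms on `M`; `b.toFun x u v` is `b_x(u, v)`, so `b.toFun x u` is `ι_u b`. -/
structure TwoForm where
  toFun : ∀ x : M, TangentSpace (𝓡 n) x →L[ℝ] TangentSpace (𝓡 n) x →L[ℝ] ℝ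
  alternating : ∀ (x : M) (u : TangentSpace (𝓡 n) x), toFun x u u = 0
  smooth : ContMDiff (𝓡 n) ((𝓡 n).prod 𝓘(ℝ, Model n →L[ℝ] Model n →L[ℝ] ℝ)) ∞
    (fun x ↦ Bundle.TotalSpace.mk' (Model n →L[ℝ] Model n →L[ℝ] ℝ)
      (E := fun x : M ↦ (TangentSpace (𝓡 n) x →L[ℝ] TangentSpace (𝓡 n) x →L[ℝ] ℝ)) x (toFun x))

/-- Smooth Riemannian metrics on `M`. -/
abbrev RiemannianMetric : Type _ :=
  Bundle.ContMDiffRiemannianMetric (𝓡 n) ∞ (Model n) (fun x : M ↦ TangentSpace (𝓡 n) x)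

end Forms

/-! ### Calculus of `1`-forms on `ℝⁿ` -/

/-- The exterior derivative `dθ(u, v) = (D_u θ)(v) - (D_v θ)(u)` of a `1`-form on `ℝⁿ`. -/
def extDerivModel {n : ℕ} (θ : Model n → Model n →L[ℝ] ℝ) (p : Model n) :
    Model n →L[ℝ] Model n →L[ℝ] ℝ :=
  fderiv ℝ θ p - (fderiv ℝ θ p).flip

/-- The Lie derivative of a `1`-form on `ℝⁿ`:
`(L_X θ)_i = X^j ∂_j θ_i + θ_j ∂_i X^j`. -/
def lieDerivModel {n : ℕ} (X : Model n → Model n) (θ : Model n → Model n →L[ℝ] ℝ) (p : Model n) :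
    Model n →L[ℝ] ℝ :=
  fderiv ℝ θ p (X p) + (θ p).comp (fderiv ℝ X p)

/-- `extDerivModel` is the exterior derivative of Mathlib in degree `1`. -/
theorem extDerivModel_apply {n : ℕ} (θ : Model n → Model n →L[ℝ] ℝ) (p u v : Model n)
    (h : DifferentiableAt ℝ θ p) :
    extDerivModel θ p u v =
      extDeriv (fun q ↦ ContinuousAlternatingMap.ofSubsingleton ℝ (Model n) ℝ (0 : Fin 1) (θ q))
        p ![u, v] := by
  have h' : DifferentiableAt ℝ (fun q ↦
      ContinuousAlternatingMap.ofSubsingleton ℝ (Model n) ℝ (0 : Fin 1) (θ q)) p :=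
    (ContinuousAlternatingMap.ofSubsingletonLIE (𝕜 := ℝ) (E := Model n) (F := ℝ)
      (0 : Fin 1)).differentiableAt.comp p h
  rw [extDeriv_apply h', Fin.sum_univ_two]
  simp [extDerivModel, Fin.removeNth, fderiv_clm_apply h (differentiableAt_const _)]
  ring

/-- `lieDerivModel` satisfies `(L_X θ)(Z) = X(θ(Z)) - θ([X, Z])`. -/
theorem lieDerivModel_apply {n : ℕ} (X Z : Model n → Model n) (θ : Model n → Model n →L[ℝ] ℝ)
    (p : Model n) (hθ : DifferentiableAt ℝ θ p) (hZ : DifferentiableAt ℝ Z p) :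
    lieDerivModel X θ p (Z p) =
      fderiv ℝ (fun q ↦ θ q (Z q)) p (X p) - θ p (VectorField.lieBracket ℝ X Z p) := by
  rw [show (fun q ↦ θ q (Z q)) = fun q ↦ (θ q) (Z q) from rfl, fderiv_clm_apply hθ hZ]
  simp [lieDerivModel, VectorField.lieBracket]

/-! ### Calculus of `1`-forms on a manifold

As for Mathlib's Lie bracket of vector fields, the operations at `x₀` are computed in the preferred
chart at `x₀`. -/

section Calculus

variable {n : ℕ} {M : Type*} [TopologicalSpace M] [ChartedSpace (Model n) M]

/-- The expression of a `1`-form in the chart at `x₀`. -/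
def formInChart (x₀ : M) (ξ : ∀ x : M, Cotangent n x) (p : Model n) : Model n →L[ℝ] ℝ :=
  (ξ ((extChartAt (𝓡 n) x₀).symm p)).comp
    (mfderivWithin 𝓘(ℝ, Model n) (𝓡 n) (extChartAt (𝓡 n) x₀).symm (range (𝓡 n)) p)

/-- The expression of a vector field in the chart at `x₀`. -/
def vectorInChart (x₀ : M) (X : ∀ x : M, Tangent n x) (p : Model n) : Model n :=
  VectorField.mpullbackWithin 𝓘(ℝ, Model n) (𝓡 n) (extChartAt (𝓡 n) x₀).symm X
    (range (𝓡 n)) p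

/-- The derivative at `x₀` of the chart at `x₀`. -/
def chartDeriv (x₀ : M) : TangentSpace (𝓡 n) x₀ →L[ℝ] Model n :=
  mfderiv (𝓡 n) 𝓘(ℝ, Model n) (extChartAt (𝓡 n) x₀) x₀

/-- `ι_u dξ` at `x₀`, for a `1`-form `ξ` and a tangent vector `u` at `x₀`, that is, the covector
`v ↦ dξ(u, v)`. -/
def contractExtDeriv (ξ : ∀ x : M, Cotangent n x) (x₀ : M) (u : Tangent n x₀) : Cotangent n x₀ :=
  (extDerivModel (formInChart x₀ ξ) (extChartAt (𝓡 n) x₀ x₀) (chartDeriv x₀ u)).comp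
    (chartDeriv x₀)

/-- The Lie derivative `L_X η` of a `1`-form `η`, at `x₀`. -/
def lieDeriv (X : ∀ x : M, Tangent n x) (η : ∀ x : M, Cotangent n x) (x₀ : M) : Cotangent n x₀ :=
  (lieDerivModel (vectorInChart x₀ X) (formInChart x₀ η) (extChartAt (𝓡 n) x₀ x₀)).comp
    (chartDeriv x₀)

/-! ### Brackets on the generalized tangent bundle -/

/-- The Dorfman bracket `[X + ξ, Y + η]_D = [X, Y] + L_X η - ι_Y dξ`. -/
def dorfman (e₁ e₂ : ∀ x : M, GTangent n x) (x : M) : GTangent n x :=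
  (VectorField.mlieBracket (𝓡 n) (fun y ↦ (e₁ y).1) (fun y ↦ (e₂ y).1) x,
    lieDeriv (fun y ↦ (e₁ y).1) (fun y ↦ (e₂ y).2) x
      - contractExtDeriv (fun y ↦ (e₁ y).2) x (e₂ x).1)

/-- The Courant bracket `[e₁, e₂]_C = ½ ([e₁, e₂]_D - [e₂, e₁]_D)`. -/
def courant (e₁ e₂ : ∀ x : M, GTangent n x) (x : M) : GTangent n x :=
  (1 / 2 : ℝ) • (dorfman e₁ e₂ x - dorfman e₂ e₁ x)

/-- The natural pairing `⟨X + ξ, Y + η⟩ = ι_X η + ι_Y ξ` on `E_x`. -/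
def pairing (x : M) : LinearMap.BilinForm ℝ (GTangent n x) :=
  LinearMap.mk₂ ℝ (fun u v ↦ v.2 u.1 + u.2 v.1)
    (by intro u u' v; simp; ring) (by intro c u v; simp; ring)
    (by intro u v v'; simp; ring) (by intro c u v; simp; ring)

@[simp] theorem pairing_apply (x : M) (u v : GTangent n x) :
    pairing x u v = v.2 u.1 + u.2 v.1 := rfl

theorem pairing_isRefl (x : M) : (pairing (n := n) x).IsRefl := by
  intro u v h
  simp only [pairing_apply] at h ⊢
  linarith

instance (x : M) : FiniteDimensional ℝ (Tangent n x) :=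
  inferInstanceAs (FiniteDimensional ℝ (Model n))

instance (x : M) : FiniteDimensional ℝ (Cotangent n x) :=
  inferInstanceAs (FiniteDimensional ℝ (Model n →L[ℝ] ℝ))

theorem finrank_tangent (x : M) : Module.finrank ℝ (Tangent n x) = n :=
  finrank_euclideanSpace_fin (𝕜 := ℝ) (n := n)

theorem finrank_cotangent (x : M) : Module.finrank ℝ (Cotangent n x) = n := by
  have h : Module.finrank ℝ (Model n →L[ℝ] ℝ) = n := by
    rw [← LinearMap.toContinuousLinearMap.finrank_eq (R := ℝ) (M := Model n →ₗ[ℝ] ℝ)]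
    rw [Module.finrank_linearMap]
    simp
  exact h

end Calculus

/-! ### Generalized metrics -/

section Metric

variable (n : ℕ) (M : Type*) [TopologicalSpace M] [ChartedSpace (Model n) M]
  [IsManifold (𝓡 n) ∞ M]

/-- A generalized metric: a smooth subbundle `V` of `TM ⊕ T*M`, of rank `n = dim M`, on which the
natural pairing is positive definite. -/
structure GeneralizedMetric where
  /-- The fibres of `V`. -/
  V : ∀ x : M, Submodule ℝ (GTangent n x)
  rank : ∀ x : M, Module.finrank ℝ (V x) = n
  posDef : ∀ (x : M) (u : GTangent n x), u ∈ V x → u ≠ 0 → 0 < pairing x u u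
  /-- `V` has smooth local frames. -/
  smooth : ∀ x₀ : M, ∃ U ∈ 𝓝 x₀, ∃ e : Fin n → ∀ x : M, GTangent n x,
    (∀ i, SmoothVectorOn (fun x ↦ (e i x).1) U ∧ SmoothCovectorOn (fun x ↦ (e i x).2) U) ∧
      ∀ x ∈ U, V x = Submodule.span ℝ (range fun i ↦ e i x)

end Metric

namespace GeneralizedMetric

variable {n : ℕ} {M : Type*} [TopologicalSpace M] [ChartedSpace (Model n) M]
  [IsManifold (𝓡 n) ∞ M]

/-- `V⁺ = V`. -/
def plus (G : GeneralizedMetric n M) (x : M) : Submodule ℝ (GTangent n x) := G.V x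

/-- `V⁻ = V^⊥`, the orthogonal complement for the natural pairing. -/
def minus (G : GeneralizedMetric n M) (x : M) : Submodule ℝ (GTangent n x) :=
  (pairing x).orthogonal (G.V x)

theorem isCompl (G : GeneralizedMetric n M) (x : M) : IsCompl (G.plus x) (G.minus x) := by
  refine (LinearMap.BilinForm.isCompl_orthogonal_iff_disjoint (pairing_isRefl x)).2 ?_
  rw [Submodule.disjoint_def]
  intro u hu hu'
  by_contra h
  exact (G.posDef x u hu h).ne' (hu' u hu)

theorem bijective_plus (G : GeneralizedMetric n M) (x : M) :
    Function.Bijective ((LinearMap.fst ℝ (Tangent n x) (Cotangent n x)).domRestrict (G.plus x)) := by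
  have hinj : Function.Injective
      ((LinearMap.fst ℝ (Tangent n x) (Cotangent n x)).domRestrict (G.plus x)) := by
    rw [injective_iff_map_eq_zero]
    rintro ⟨⟨X, ξ⟩, hu⟩ h
    have hX : X = 0 := h
    subst hX
    by_contra hne
    have := G.posDef x _ hu (fun h0 ↦ hne (Subtype.ext h0))
    simp at this
  have h : Module.finrank ℝ (G.plus x) = Module.finrank ℝ (Tangent n x) :=
    (G.rank x).trans (finrank_tangent x).symm
  exact ⟨hinj, (LinearMap.injective_iff_surjective_of_finrank_eq_finrank
    (V := G.plus x) (V₂ := Tangent n x) h).1 hinj⟩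

theorem bijective_minus (G : GeneralizedMetric n M) (x : M) :
    Function.Bijective
      ((LinearMap.fst ℝ (Tangent n x) (Cotangent n x)).domRestrict (G.minus x)) := by
  have hinj : Function.Injective
      ((LinearMap.fst ℝ (Tangent n x) (Cotangent n x)).domRestrict (G.minus x)) := by
    rw [injective_iff_map_eq_zero]
    rintro ⟨⟨X, ξ⟩, hu⟩ h
    have hX : X = 0 := h
    subst hX
    have hξ : ξ = 0 := by
      ext Y
      obtain ⟨v, hv⟩ := (G.bijective_plus x).2 Y
      have h1 := hu v.1 v.2
      have h2 : (v.1).1 = Y := hv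
      have h3 : pairing x v.1 (0, ξ) = 0 := h1
      simpa [h2] using h3
    subst hξ
    rfl
  have h := Submodule.finrank_add_eq_of_isCompl (G.isCompl x)
  rw [Module.finrank_prod, finrank_tangent, finrank_cotangent] at h
  have h' : Module.finrank ℝ (G.plus x) = n := G.rank x
  have h2 : Module.finrank ℝ (G.minus x) = Module.finrank ℝ (Tangent n x) := by
    rw [finrank_tangent]
    omega
  exact ⟨hinj, (LinearMap.injective_iff_surjective_of_finrank_eq_finrank
    (V := G.minus x) (V₂ := Tangent n x) h2).1 hinj⟩

/-- `X⁺`, the section of `V⁺` with `π(X⁺) = X`. -/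
def liftPlus (G : GeneralizedMetric n M) (X : ∀ x : M, Tangent n x) (x : M) : GTangent n x :=
  ((LinearEquiv.ofBijective _ (G.bijective_plus x)).symm (X x) : G.plus x)

/-- `X⁻`, the section of `V⁻` with `π(X⁻) = X`. -/
def liftMinus (G : GeneralizedMetric n M) (X : ∀ x : M, Tangent n x) (x : M) : GTangent n x :=
  ((LinearEquiv.ofBijective _ (G.bijective_minus x)).symm (X x) : G.minus x)

/-- The projection `u ↦ u₊` of `E_x` onto `V⁺` along `V⁻`. -/
def projPlus (G : GeneralizedMetric n M) (x : M) : GTangent n x →ₗ[ℝ] G.plus x :=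
  Submodule.projectionOnto (G.plus x) (G.minus x) (G.isCompl x)

/-- The affine connection `∇⁺_X Y = π(([X⁻, Y⁺]_C)₊)` induced on `M`. -/
def connection (G : GeneralizedMetric n M) (X Y : SmoothField n M) (x : M) : Tangent n x :=
  (G.projPlus x (courant (G.liftMinus X.toFun) (G.liftPlus Y.toFun) x) : GTangent n x).1

end GeneralizedMetric

end GeneralizedGeometry

end

namespace GeneralizedGeometry

set_option synthInstance.maxHeartbeats 400000

/-! The `B`-field transformation by `dα`, called `twist`, is a symmetry of every ingredient of the
connection. It is an isometry of the pairing because `dα` is skew (`pairing_twist`), it respects the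
Courant bracket because `dα` is closed (`courant_twist`), and it does not change the tangent
component. It carries `V⁺` onto `W⁺`, hence `V⁻` into `W⁻`, so it intertwines the lifts and the
projections (`projPlus_twist`). Applying `π`, which does not see `twist`, gives equal connections.

The analytic core is the Cartan identity `lieDerivModel_sub_extDerivModel`, proved on `ℝⁿ`. Carrying
it to `M` takes `formInChart_contractExtDeriv`: `ι_X dξ` is defined at each point through that
point's own chart, so its expression in one fixed chart rests on naturality of `d`. -/

theorem two_le_infty : (2 : WithTop ℕ∞) ≤ ∞ :=
  WithTop.coe_le_coe.2 (le_top : (2 : ℕ∞) ≤ ⊤)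

/-! ### Exterior and Lie derivatives of `1`-forms on `ℝⁿ`. -/

section ModelCalculus

variable {n : ℕ}

theorem extDerivModel_apply_apply (θ : Model n → Model n →L[ℝ] ℝ) (p u v : Model n) :
    extDerivModel θ p u v = fderiv ℝ θ p u v - fderiv ℝ θ p v u := by
  simp [extDerivModel]

theorem extDerivModel_swap (θ : Model n → Model n →L[ℝ] ℝ) (p u v : Model n) :
    extDerivModel θ p u v = -extDerivModel θ p v u := by
  simp [extDerivModel]

theorem extDerivModel_add {θ η : Model n → Model n →L[ℝ] ℝ} {p : Model n}
    (hθ : DifferentiableAt ℝ θ p) (hη : DifferentiableAt ℝ η p) :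
    extDerivModel (fun q ↦ θ q + η q) p = extDerivModel θ p + extDerivModel η p := by
  ext u v
  simp only [extDerivModel_apply_apply, add_apply, fderiv_fun_add hθ hη]
  ring

theorem lieDerivModel_add (X : Model n → Model n) {θ η : Model n → Model n →L[ℝ] ℝ}
    {p : Model n} (hθ : DifferentiableAt ℝ θ p) (hη : DifferentiableAt ℝ η p) :
    lieDerivModel X (fun q ↦ θ q + η q) p = lieDerivModel X θ p + lieDerivModel X η p := by
  ext v
  simp only [lieDerivModel, add_apply, fderiv_fun_add hθ hη,
    ContinuousLinearMap.comp_apply]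
  ring

theorem extDerivModel_congr {θ η : Model n → Model n →L[ℝ] ℝ} {p : Model n}
    (h : θ =ᶠ[𝓝 p] η) : extDerivModel θ p = extDerivModel η p := by
  rw [extDerivModel, extDerivModel, h.fderiv_eq]

theorem lieDerivModel_congr (X : Model n → Model n) {θ η : Model n → Model n →L[ℝ] ℝ}
    {p : Model n} (h : θ =ᶠ[𝓝 p] η) : lieDerivModel X θ p = lieDerivModel X η p := by
  rw [lieDerivModel, lieDerivModel, h.fderiv_eq, h.eq_of_nhds]

/-- The exterior derivative of `1`-forms commutes with pullback. -/
theorem extDerivModel_pullback {θ : Model n → Model n →L[ℝ] ℝ} {τ : Model n → Model n}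
    {p : Model n} (hθ : DifferentiableAt ℝ θ (τ p)) (hτ : ContDiffAt ℝ 2 τ p) (u v : Model n) :
    extDerivModel (fun q ↦ (θ (τ q)).comp (fderiv ℝ τ q)) p u v =
      extDerivModel θ (τ p) (fderiv ℝ τ p u) (fderiv ℝ τ p v) := by
  have hτ1 : DifferentiableAt ℝ τ p := hτ.differentiableAt (by norm_num)
  have hτ2 : DifferentiableAt ℝ (fderiv ℝ τ) p :=
    (hτ.fderiv_right (m := 1) (by norm_num)).differentiableAt (by norm_num)
  -- The product rule also produces `D²τ`; its symmetry removes that term from the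
  -- antisymmetrization.
  have hsymm : fderiv ℝ (fderiv ℝ τ) p u v = fderiv ℝ (fderiv ℝ τ) p v u :=
    (hτ.isSymmSndFDerivAt (by simp)) u v
  have hcomp : HasFDerivAt (fun q ↦ θ (τ q)) ((fderiv ℝ θ (τ p)).comp (fderiv ℝ τ p)) p :=
    hθ.hasFDerivAt.comp p hτ1.hasFDerivAt
  have h := (hcomp.clm_comp hτ2.hasFDerivAt).fderiv
  simp only [extDerivModel_apply_apply, h]
  simp [hsymm]

/-- Flipping is continuous and linear, so it commutes with differentiation. Taking `f = Dθ` gives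
the derivative of `extDerivModel θ`. -/
theorem hasFDerivAt_sub_flip {E F H : Type*} [NormedAddCommGroup E] [NormedSpace ℝ E]
    [NormedAddCommGroup F] [NormedSpace ℝ F]
    [NormedAddCommGroup H] [NormedSpace ℝ H] {f : E → F →L[ℝ] F →L[ℝ] H} {p : E}
    (hf : DifferentiableAt ℝ f p) :
    ∃ D : E →L[ℝ] F →L[ℝ] F →L[ℝ] H, HasFDerivAt (fun q ↦ f q - (f q).flip) D p ∧
      ∀ u v w, D u v w = fderiv ℝ f p u v w - fderiv ℝ f p u w v := by
  have h1 := (ContinuousLinearMap.flipₗᵢ ℝ F F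
    H).toContinuousLinearEquiv.toContinuousLinearMap.hasFDerivAt (x := f p)
  have h2 := HasFDerivAt.comp (𝕜 := ℝ) (E := E) (F := F →L[ℝ] F →L[ℝ] H)
    (G := F →L[ℝ] F →L[ℝ] H) p h1 hf.hasFDerivAt
  have h3 := HasFDerivAt.sub (𝕜 := ℝ) (E := E) (F := F →L[ℝ] F →L[ℝ] H) hf.hasFDerivAt h2
  exact ⟨_, h3, fun _ _ _ ↦ rfl⟩

theorem hasFDerivAt_extDerivModel {θ : Model n → Model n →L[ℝ] ℝ} {p : Model n}
    (hθ : ContDiffAt ℝ 2 θ p) :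
    ∃ D : Model n →L[ℝ] Model n →L[ℝ] Model n →L[ℝ] ℝ, HasFDerivAt (extDerivModel θ) D p ∧
      ∀ u v w, D u v w =
        fderiv ℝ (fderiv ℝ θ) p u v w - fderiv ℝ (fderiv ℝ θ) p u w v :=
  hasFDerivAt_sub_flip
    ((hθ.fderiv_right (m := 1) (by norm_num)).differentiableAt (by norm_num))

theorem differentiableAt_extDerivModel {θ : Model n → Model n →L[ℝ] ℝ} {p : Model n}
    (hθ : ContDiffAt ℝ 2 θ p) : DifferentiableAt ℝ (extDerivModel θ) p := by
  obtain ⟨D, hD, -⟩ := hasFDerivAt_extDerivModel hθ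
  exact hD.differentiableAt

theorem fderiv_extDerivModel {θ : Model n → Model n →L[ℝ] ℝ} {p : Model n}
    (hθ : ContDiffAt ℝ 2 θ p) (u v w : Model n) :
    fderiv ℝ (extDerivModel θ) p u v w =
      fderiv ℝ (fderiv ℝ θ) p u v w - fderiv ℝ (fderiv ℝ θ) p u w v := by
  obtain ⟨D, hD, hD'⟩ := hasFDerivAt_extDerivModel hθ
  rw [hD.fderiv, hD']

/-- `d (d θ) = 0` for a `1`-form `θ`. -/
theorem fderiv_extDerivModel_cyclic {θ : Model n → Model n →L[ℝ] ℝ} {p : Model n}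
    (hθ : ContDiffAt ℝ 2 θ p) (u v w : Model n) :
    fderiv ℝ (extDerivModel θ) p u v w + fderiv ℝ (extDerivModel θ) p v w u +
      fderiv ℝ (extDerivModel θ) p w u v = 0 := by
  -- `D²θ` is symmetric in its first two arguments, so the six terms of the cyclic sum cancel in
  -- pairs.
  have hsymm := hθ.isSymmSndFDerivAt (by simp)
  simp only [fderiv_extDerivModel hθ]
  rw [hsymm u v, hsymm v w, hsymm w u]
  ring

theorem fderiv_extDerivModel_swap {θ : Model n → Model n →L[ℝ] ℝ} {p : Model n}
    (hθ : ContDiffAt ℝ 2 θ p) (u v w : Model n) :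
    fderiv ℝ (extDerivModel θ) p u v w = -fderiv ℝ (extDerivModel θ) p u w v := by
  simp only [fderiv_extDerivModel hθ]
  ring

/-- `L_X ι_Y dθ - ι_Y d ι_X dθ = ι_[X, Y] dθ`. -/
theorem lieDerivModel_sub_extDerivModel {θ : Model n → Model n →L[ℝ] ℝ}
    {X Y : Model n → Model n} {p : Model n} (hθ : ContDiffAt ℝ 2 θ p)
    (hX : DifferentiableAt ℝ X p) (hY : DifferentiableAt ℝ Y p) :
    lieDerivModel X (fun q ↦ extDerivModel θ q (Y q)) p -
        extDerivModel (fun q ↦ extDerivModel θ q (X q)) p (Y p) =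
      extDerivModel θ p (VectorField.lieBracket ℝ X Y p) := by
  have hd := differentiableAt_extDerivModel hθ
  have h : ∀ Z : Model n → Model n, DifferentiableAt ℝ Z p → ∀ u w,
      fderiv ℝ (fun q ↦ extDerivModel θ q (Z q)) p u w =
        extDerivModel θ p (fderiv ℝ Z p u) w + fderiv ℝ (extDerivModel θ) p u (Z p) w := by
    intro Z hZ u w
    rw [(hd.hasFDerivAt.clm_apply hZ.hasFDerivAt).fderiv]
    simp
  ext w
  simp only [lieDerivModel, sub_apply, add_apply,
    ContinuousLinearMap.comp_apply, extDerivModel_apply_apply (fun q ↦ extDerivModel θ q (X q)),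
    h X hX, h Y hY, VectorField.lieBracket, map_sub]
  -- The terms with `DX(Y)` and `DY(X)` already form the bracket. Closedness removes the derivatives
  -- of `dθ`, and skewness the two terms containing `DX(w)`.
  have h1 := fderiv_extDerivModel_cyclic hθ (X p) (Y p) w
  have h2 := fderiv_extDerivModel_swap hθ (Y p) (X p) w
  have h3 := extDerivModel_swap θ p (Y p) (fderiv ℝ X p w)
  linarith

end ModelCalculus

/-! ### Fields and forms in charts, and independence of the chart. -/

section Charts

variable {n : ℕ} {M : Type*} [TopologicalSpace M] [ChartedSpace (Model n) M]
  [IsManifold (𝓡 n) ∞ M]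

/-- `T_x M` is the model space, identified through the preferred chart at `x`, so that chart has
identity derivative at `x`. -/
theorem chartDeriv_apply (x : M) (v : Tangent n x) : chartDeriv x v = v := by
  have : IsManifold (𝓡 n) 1 M := .of_le (n := ∞) (by simp)
  exact DFunLike.congr_fun (mfderiv_extChartAt_self (I := 𝓡 n) (x := x)) v

theorem contractExtDeriv_eq (ξ : ∀ x : M, Cotangent n x) (x : M) (u : Tangent n x) :
    contractExtDeriv ξ x u = extDerivModel (formInChart x ξ) (extChartAt (𝓡 n) x x) u := by
  refine ContinuousLinearMap.ext fun v ↦ ?_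
  change extDerivModel _ _ (chartDeriv x u) (chartDeriv x v) = _
  rw [chartDeriv_apply, chartDeriv_apply]
  rfl

theorem lieDeriv_eq (X : ∀ x : M, Tangent n x) (ξ : ∀ x : M, Cotangent n x) (x : M) :
    lieDeriv X ξ x =
      lieDerivModel (vectorInChart x X) (formInChart x ξ) (extChartAt (𝓡 n) x x) := by
  refine ContinuousLinearMap.ext fun v ↦ ?_
  change lieDerivModel _ _ _ (chartDeriv x v) = _
  rw [chartDeriv_apply]
  rfl

theorem vectorInChart_self (X : ∀ x : M, Tangent n x) (x : M) :
    vectorInChart x X (extChartAt (𝓡 n) x x) = X x := by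
  have : IsManifold (𝓡 n) 1 M := .of_le (n := ∞) (by simp)
  have h := mfderivWithin_extChartAt_symm_inverse_apply (I := 𝓡 n) (x := x)
    (X ((extChartAt (𝓡 n) x).symm (extChartAt (𝓡 n) x x)))
  refine Eq.trans h ?_
  exact eq_of_heq (congr_arg_heq X (extChartAt_to_inv x))

theorem mlieBracket_eq (X Y : ∀ x : M, Tangent n x) (x : M) :
    VectorField.mlieBracket (𝓡 n) X Y x =
      VectorField.lieBracket ℝ (vectorInChart x X) (vectorInChart x Y)
        (extChartAt (𝓡 n) x x) := by
  have : IsManifold (𝓡 n) 1 M := .of_le (n := ∞) (by simp)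
  have h : (mfderiv (𝓡 n) 𝓘(ℝ, Model n) (extChartAt (𝓡 n) x) x).inverse =
      ContinuousLinearMap.id ℝ (Model n) :=
    (congr_arg ContinuousLinearMap.inverse
      (mfderiv_extChartAt_self (I := 𝓡 n) (x := x))).trans ContinuousLinearMap.inverse_id
  rw [← VectorField.mlieBracketWithin_univ, VectorField.mlieBracketWithin_apply]
  refine (DFunLike.congr_fun h _).trans ?_
  rw [preimage_univ, univ_inter]
  have h' : range (𝓡 n) = univ := ModelWithCorners.range_eq_univ _
  have h'' := VectorField.lieBracketWithin_univ (𝕜 := ℝ) (V := vectorInChart x X)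
    (W := vectorInChart x Y)
  rw [← h'] at h''
  exact congr_fun h'' _

theorem contDiffAt_vectorInChart {X : ∀ x : M, Tangent n x} (hX : SmoothVectorOn X univ) (x : M) :
    ContDiffAt ℝ ∞ (vectorInChart x X) (extChartAt (𝓡 n) x x) := by
  have h := VectorField.contMDiffWithinAt_mpullbackWithin_extChartAt_symm (m := ∞) (n := ∞)
    (hX x (mem_univ x)) uniqueMDiffOn_univ (mem_univ x) (by simp)
  rw [preimage_univ, inter_univ] at h
  exact ((contMDiffWithinAt_vectorSpace_iff_contDiffWithinAt.1 h).contDiffAt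
    (extChartAt_target_mem_nhds x))

/-- Smoothness of a section is expressed in bundle trivializations; this identifies those
coordinates with `formInChart`, which can then be differentiated. -/
theorem inCoordinates_eq_formInChart (ξ : ∀ x : M, Cotangent n x) (x₀ : M) {y : M}
    (hy : y ∈ (chartAt (Model n) x₀).source) :
    ContinuousLinearMap.inCoordinates (Model n) (fun x : M ↦ TangentSpace (𝓡 n) x) ℝ
      (fun _ : M ↦ ℝ) x₀ y x₀ y (ξ y) = formInChart x₀ ξ (extChartAt (𝓡 n) x₀ y) := by
  have : IsManifold (𝓡 n) 1 M := .of_le (n := ∞) (by simp)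
  refine ContinuousLinearMap.ext fun v ↦ ?_
  have h : (extChartAt (𝓡 n) x₀).symm (extChartAt (𝓡 n) x₀ y) = y :=
    (extChartAt (𝓡 n) x₀).left_inv (by simpa using hy)
  have h1 := DFunLike.congr_fun (TangentBundle.symmL_trivializationAt (I := 𝓡 n) hy) v
  refine Eq.trans (b := ξ y ((trivializationAt (Model n) (TangentSpace (𝓡 n)) x₀).symmL ℝ y v))
    ?_ ?_
  · simp [ContinuousLinearMap.inCoordinates]
  · refine Eq.trans (congr_arg (ξ y) h1) ?_
    -- `ξ` is a dependent function, so the base point is changed by substitution; all tangent spaces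
    -- unfold to `Model n`.
    have h2 : ∀ z, z = y → ∀ w : Model n, ξ y w = ξ z w := by rintro _ rfl _; rfl
    exact h2 _ h _

theorem contDiffAt_formInChart {ξ : ∀ x : M, Cotangent n x} (hξ : SmoothCovectorOn ξ univ)
    (x : M) : ContDiffAt ℝ ∞ (formInChart x ξ) (extChartAt (𝓡 n) x x) := by
  have h1 := ((contMDiffAt_hom_bundle _).1 ((hξ x (mem_univ x)).contMDiffAt Filter.univ_mem)).2
  have h2 : ContMDiffAt 𝓘(ℝ, Model n) (𝓡 n) ∞ (extChartAt (𝓡 n) x).symm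
      (extChartAt (𝓡 n) x x) :=
    (contMDiffOn_extChartAt_symm x).contMDiffAt (extChartAt_target_mem_nhds x)
  have h3 := ContMDiffAt.comp_of_eq h1 h2 (extChartAt_to_inv x)
  refine (contMDiffAt_iff_contDiffAt.1 h3).congr_of_eventuallyEq ?_
  filter_upwards [extChartAt_target_mem_nhds (I := 𝓡 n) x] with q hq
  have h4 := inCoordinates_eq_formInChart ξ x (y := (extChartAt (𝓡 n) x).symm q)
    (by simpa using (extChartAt (𝓡 n) x).map_target hq)
  rw [(extChartAt (𝓡 n) x).right_inv hq] at h4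
  exact h4.symm

omit [IsManifold (𝓡 n) ∞ M] in
theorem formInChart_apply (ξ : ∀ x : M, Cotangent n x) (x₀ : M) (p v : Model n) :
    formInChart x₀ ξ p v = ξ ((extChartAt (𝓡 n) x₀).symm p)
      (mfderiv 𝓘(ℝ, Model n) (𝓡 n) (extChartAt (𝓡 n) x₀).symm p v) := by
  have h : mfderivWithin 𝓘(ℝ, Model n) (𝓡 n) (extChartAt (𝓡 n) x₀).symm (range (𝓡 n)) p =
      mfderiv 𝓘(ℝ, Model n) (𝓡 n) (extChartAt (𝓡 n) x₀).symm p := by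
    rw [ModelWithCorners.range_eq_univ, mfderivWithin_univ]
  rw [← h]
  rfl

theorem vectorInChart_apply (X : ∀ x : M, Tangent n x) (x₀ : M) (p : Model n)
    (hp : p ∈ (extChartAt (𝓡 n) x₀).target) :
    mfderiv 𝓘(ℝ, Model n) (𝓡 n) (extChartAt (𝓡 n) x₀).symm p (vectorInChart x₀ X p) =
      X ((extChartAt (𝓡 n) x₀).symm p) := by
  have : IsManifold (𝓡 n) 1 M := .of_le (n := ∞) (by simp)
  have h : mfderivWithin 𝓘(ℝ, Model n) (𝓡 n) (extChartAt (𝓡 n) x₀).symm (range (𝓡 n)) p =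
      mfderiv 𝓘(ℝ, Model n) (𝓡 n) (extChartAt (𝓡 n) x₀).symm p := by
    rw [ModelWithCorners.range_eq_univ, mfderivWithin_univ]
  rw [← h]
  exact (isInvertible_mfderivWithin_extChartAt_symm hp).self_apply_inverse _

theorem mdifferentiableAt_extChartAt_symm (x₀ : M) {p : Model n}
    (hp : p ∈ (extChartAt (𝓡 n) x₀).target) :
    MDifferentiableAt 𝓘(ℝ, Model n) (𝓡 n) (extChartAt (𝓡 n) x₀).symm p :=
  ((contMDiffOn_extChartAt_symm (n := ∞) x₀).contMDiffAt
    ((isOpen_extChartAt_target x₀).mem_nhds hp)).mdifferentiableAt (by simp)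

theorem fderiv_transition (x₀ y : M) {p : Model n} (hp : p ∈ (extChartAt (𝓡 n) x₀).target)
    (hy : (extChartAt (𝓡 n) x₀).symm p ∈ (extChartAt (𝓡 n) y).source) (v : Model n) :
    fderiv ℝ (extChartAt (𝓡 n) y ∘ (extChartAt (𝓡 n) x₀).symm) p v =
      mfderiv (𝓡 n) 𝓘(ℝ, Model n) (extChartAt (𝓡 n) y) ((extChartAt (𝓡 n) x₀).symm p)
        (mfderiv 𝓘(ℝ, Model n) (𝓡 n) (extChartAt (𝓡 n) x₀).symm p v) := by
  have : IsManifold (𝓡 n) 1 M := .of_le (n := ∞) (by simp)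
  rw [← mfderiv_eq_fderiv, mfderiv_comp (I' := 𝓡 n) p
    (mdifferentiableAt_extChartAt (by simpa using hy)) (mdifferentiableAt_extChartAt_symm x₀ hp)]
  rfl

theorem formInChart_eq_comp_transition (ξ : ∀ x : M, Cotangent n x) (x₀ y : M)
    {p : Model n} (hp : p ∈ (extChartAt (𝓡 n) x₀).target)
    (hy : (extChartAt (𝓡 n) x₀).symm p ∈ (extChartAt (𝓡 n) y).source) :
    formInChart x₀ ξ p =
      (formInChart y ξ ((extChartAt (𝓡 n) y ∘ (extChartAt (𝓡 n) x₀).symm) p)).comp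
        (fderiv ℝ (extChartAt (𝓡 n) y ∘ (extChartAt (𝓡 n) x₀).symm) p) := by
  have : IsManifold (𝓡 n) 1 M := .of_le (n := ∞) (by simp)
  refine ContinuousLinearMap.ext fun v ↦ ?_
  rw [ContinuousLinearMap.comp_apply, formInChart_apply, formInChart_apply,
    fderiv_transition x₀ y hp hy]
  have h1 : (extChartAt (𝓡 n) y).symm ((extChartAt (𝓡 n) y ∘ (extChartAt (𝓡 n) x₀).symm) p) =
    (extChartAt (𝓡 n) x₀).symm p := (extChartAt (𝓡 n) y).left_inv hy
  have h2 : ∀ z z', z = z' → ∀ w : Model n, ξ z w = ξ z' w := by rintro _ _ rfl _; rfl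
  refine Eq.trans ?_ (h2 _ _ h1.symm _)
  congr 1
  have h3 := mfderivWithin_extChartAt_symm_comp_mfderiv_extChartAt' (I := 𝓡 n) hy
  rw [ModelWithCorners.range_eq_univ, mfderivWithin_univ] at h3
  exact (DFunLike.congr_fun h3 _).symm

/-- `ι_X dξ` in a chart is computed by the exterior derivative of the expression of `ξ`. -/
theorem formInChart_contractExtDeriv {ξ : ∀ x : M, Cotangent n x}
    (hξ : SmoothCovectorOn ξ univ) (X : ∀ x : M, Tangent n x) (x₀ : M) {p : Model n}
    (hp : p ∈ (extChartAt (𝓡 n) x₀).target) :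
    formInChart x₀ (fun y ↦ contractExtDeriv ξ y (X y)) p =
      extDerivModel (formInChart x₀ ξ) p (vectorInChart x₀ X p) := by
  -- At `y`, `contractExtDeriv` uses the chart at `y` rather than the one at `x₀`. The transition
  -- map `τ` compares the two, and `extDerivModel_pullback` transports `dξ` along it.
  set y := (extChartAt (𝓡 n) x₀).symm p
  have hy : y ∈ (extChartAt (𝓡 n) y).source := mem_extChartAt_source y
  set τ : Model n → Model n := extChartAt (𝓡 n) y ∘ (extChartAt (𝓡 n) x₀).symm with hτ_def
  have hsymm : ContMDiffAt 𝓘(ℝ, Model n) (𝓡 n) ∞ (extChartAt (𝓡 n) x₀).symm p :=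
    (contMDiffOn_extChartAt_symm x₀).contMDiffAt ((isOpen_extChartAt_target x₀).mem_nhds hp)
  have hτ : ContDiffAt ℝ ∞ τ p :=
    contMDiffAt_iff_contDiffAt.1 ((contMDiffAt_extChartAt (x := y)).comp p hsymm)
  have hev : formInChart x₀ ξ =ᶠ[𝓝 p] fun q ↦ (formInChart y ξ (τ q)).comp (fderiv ℝ τ q) := by
    filter_upwards [(isOpen_extChartAt_target x₀).mem_nhds hp,
      hsymm.continuousAt.preimage_mem_nhds ((isOpen_extChartAt_source (I := 𝓡 n) y).mem_nhds hy)]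
      with q hq hq'
    exact formInChart_eq_comp_transition ξ x₀ y hq hq'
  -- The chart at `y` has identity derivative at `y`, so only the inverse chart at `x₀` contributes.
  have hτv : ∀ v : Model n, fderiv ℝ τ p v =
      mfderiv 𝓘(ℝ, Model n) (𝓡 n) (extChartAt (𝓡 n) x₀).symm p v := by
    intro v
    rw [hτ_def, fderiv_transition x₀ y hp hy]
    exact chartDeriv_apply y _
  refine ContinuousLinearMap.ext fun v ↦ ?_
  rw [extDerivModel_congr hev,
    extDerivModel_pullback ((contDiffAt_formInChart hξ y).differentiableAt (by simp))
    (hτ.of_le two_le_infty), hτv, hτv, vectorInChart_apply X x₀ p hp,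
    formInChart_apply, contractExtDeriv_eq]
  rfl

end Charts

/-! ### The `B`-field transformation by `dα`: brackets and pairing. -/

section Twist

variable {n : ℕ} {M : Type*} [TopologicalSpace M] [ChartedSpace (Model n) M]
  [IsManifold (𝓡 n) ∞ M]

theorem SmoothCovectorOn.add {ξ η : ∀ x : M, Cotangent n x} {U : Set M}
    (hξ : SmoothCovectorOn ξ U) (hη : SmoothCovectorOn η U) :
    SmoothCovectorOn (fun x ↦ ξ x + η x) U :=
  ContMDiffOn.add_section hξ hη

theorem SmoothCovectorOn.neg {ξ : ∀ x : M, Cotangent n x} {U : Set M}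
    (hξ : SmoothCovectorOn ξ U) : SmoothCovectorOn (fun x ↦ -ξ x) U :=
  ContMDiffOn.neg_section hξ

theorem smoothCovectorOn_metric (g : RiemannianMetric n M) (X : SmoothField n M) :
    SmoothCovectorOn (fun x ↦ g.inner x (X.toFun x)) univ :=
  ContMDiffOn.clm_bundle_apply g.contMDiff.contMDiffOn X.smooth

theorem smoothCovectorOn_contract (b : TwoForm n M) (X : SmoothField n M) :
    SmoothCovectorOn (fun x ↦ b.toFun x (X.toFun x)) univ :=
  ContMDiffOn.clm_bundle_apply b.smooth.contMDiffOn X.smooth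

omit [IsManifold (𝓡 n) ∞ M] in
theorem formInChart_add (ξ η : ∀ x : M, Cotangent n x) (x : M) :
    formInChart x (fun y ↦ ξ y + η y) = fun p ↦ formInChart x ξ p + formInChart x η p := rfl

/-- Equality near the base point is needed, since both terms of the Dorfman bracket differentiate
this form. -/
theorem formInChart_contractExtDeriv_eventuallyEq {α : ∀ x : M, Cotangent n x}
    (hα : SmoothCovectorOn α univ) (X : ∀ x : M, Tangent n x) (x : M) :
    formInChart x (fun y ↦ contractExtDeriv α y (X y)) =ᶠ[𝓝 (extChartAt (𝓡 n) x x)]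
      fun p ↦ extDerivModel (formInChart x α) p (vectorInChart x X p) := by
  filter_upwards [extChartAt_target_mem_nhds (I := 𝓡 n) x] with p hp
  exact formInChart_contractExtDeriv hα X x hp

/-- A closed `B`-field `dα` acts on the Dorfman bracket by automorphisms. -/
theorem dorfman_twist {α : ∀ x : M, Cotangent n x} (hα : SmoothCovectorOn α univ)
    {X Y : ∀ x : M, Tangent n x} (hX : SmoothVectorOn X univ) (hY : SmoothVectorOn Y univ)
    {ξ η : ∀ x : M, Cotangent n x} (hξ : SmoothCovectorOn ξ univ) (hη : SmoothCovectorOn η univ)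
    (x : M) :
    dorfman (fun y ↦ (X y, ξ y + contractExtDeriv α y (X y)))
        (fun y ↦ (Y y, η y + contractExtDeriv α y (Y y))) x =
      dorfman (fun y ↦ (X y, ξ y)) (fun y ↦ (Y y, η y)) x +
        (0, contractExtDeriv α x (VectorField.mlieBracket (𝓡 n) X Y x)) := by
  set p := extChartAt (𝓡 n) x x
  have hα2 : ContDiffAt ℝ 2 (formInChart x α) p := (contDiffAt_formInChart hα x).of_le two_le_infty
  have hX1 : DifferentiableAt ℝ (vectorInChart x X) p :=
    (contDiffAt_vectorInChart hX x).differentiableAt (by simp)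
  have hY1 : DifferentiableAt ℝ (vectorInChart x Y) p :=
    (contDiffAt_vectorInChart hY x).differentiableAt (by simp)
  have hξ1 : DifferentiableAt ℝ (formInChart x ξ) p :=
    (contDiffAt_formInChart hξ x).differentiableAt (by simp)
  have hη1 : DifferentiableAt ℝ (formInChart x η) p :=
    (contDiffAt_formInChart hη x).differentiableAt (by simp)
  have hd := differentiableAt_extDerivModel hα2
  have hevX := formInChart_contractExtDeriv_eventuallyEq hα X x
  have hevY := formInChart_contractExtDeriv_eventuallyEq hα Y x
  have hdX : DifferentiableAt ℝ
      (formInChart x (fun y ↦ contractExtDeriv α y (X y))) p :=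
    (hd.clm_apply hX1).congr_of_eventuallyEq hevX
  have hdY : DifferentiableAt ℝ
      (formInChart x (fun y ↦ contractExtDeriv α y (Y y))) p :=
    (hd.clm_apply hY1).congr_of_eventuallyEq hevY
  have hkey := lieDerivModel_sub_extDerivModel hα2 hX1 hY1
  have hYx : vectorInChart x Y p = Y x := vectorInChart_self Y x
  rw [hYx, ← lieDerivModel_congr _ hevY, ← extDerivModel_congr hevX] at hkey
  -- The tangent parts agree at once; the cotangent parts differ by the Cartan identity `hkey`.
  refine Prod.ext (add_zero _).symm ?_
  change lieDeriv X (fun y ↦ η y + contractExtDeriv α y (Y y)) x -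
      contractExtDeriv (fun y ↦ ξ y + contractExtDeriv α y (X y)) x (Y x) =
    lieDeriv X η x - contractExtDeriv ξ x (Y x) +
      contractExtDeriv α x (VectorField.mlieBracket (𝓡 n) X Y x)
  rw [lieDeriv_eq, lieDeriv_eq, contractExtDeriv_eq, contractExtDeriv_eq, contractExtDeriv_eq,
    mlieBracket_eq, formInChart_add, formInChart_add, lieDerivModel_add _ hη1 hdY,
    extDerivModel_add hξ1 hdX]
  refine Eq.trans ?_ (congr_arg _ hkey)
  exact add_sub_add_comm _ _ (extDerivModel (formInChart x ξ) p (Y x))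
    (extDerivModel (formInChart x fun y ↦ contractExtDeriv α y (X y)) p (Y x))

/-- The `B`-field transformation `X + ξ ↦ X + ξ + ι_X dα` of `E_x`. -/
noncomputable def twist (α : ∀ x : M, Cotangent n x) (x : M) (u : GTangent n x) : GTangent n x :=
  (u.1, u.2 + contractExtDeriv α x u.1)

theorem contractExtDeriv_swap (α : ∀ x : M, Cotangent n x) (x : M) (u v : Tangent n x) :
    contractExtDeriv α x u v = -contractExtDeriv α x v u := by
  rw [contractExtDeriv_eq, contractExtDeriv_eq]
  exact extDerivModel_swap _ _ _ _

theorem contractExtDeriv_add (α : ∀ x : M, Cotangent n x) (x : M) (u v : Tangent n x) :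
    contractExtDeriv α x (u + v) = contractExtDeriv α x u + contractExtDeriv α x v := by
  simp only [contractExtDeriv_eq]
  exact map_add (extDerivModel (formInChart x α) _) u v

theorem contractExtDeriv_sub (α : ∀ x : M, Cotangent n x) (x : M) (u v : Tangent n x) :
    contractExtDeriv α x (u - v) = contractExtDeriv α x u - contractExtDeriv α x v := by
  simp only [contractExtDeriv_eq]
  exact map_sub (extDerivModel (formInChart x α) _) u v

theorem contractExtDeriv_smul (α : ∀ x : M, Cotangent n x) (x : M) (c : ℝ) (u : Tangent n x) :
    contractExtDeriv α x (c • u) = c • contractExtDeriv α x u := by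
  simp only [contractExtDeriv_eq]
  exact map_smul (extDerivModel (formInChart x α) _) c u

/-- The two Dorfman corrections are `dα` contracted with the tangent parts of the brackets. By
linearity their half-difference is `dα` contracted with the tangent part of the Courant bracket. -/
theorem courant_twist {α : ∀ x : M, Cotangent n x} (hα : SmoothCovectorOn α univ)
    {X Y : ∀ x : M, Tangent n x} (hX : SmoothVectorOn X univ) (hY : SmoothVectorOn Y univ)
    {ξ η : ∀ x : M, Cotangent n x} (hξ : SmoothCovectorOn ξ univ) (hη : SmoothCovectorOn η univ)
    (x : M) :
    courant (fun y ↦ twist α y (X y, ξ y)) (fun y ↦ twist α y (Y y, η y)) x =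
      twist α x (courant (fun y ↦ (X y, ξ y)) (fun y ↦ (Y y, η y)) x) := by
  have h1 := dorfman_twist hα hX hY hξ hη x
  have h2 := dorfman_twist hα hY hX hη hξ x
  simp only [courant, twist]
  rw [h1, h2]
  refine Prod.ext ?_ ?_
  · simp
  · simp only [Prod.smul_snd, Prod.snd_sub, Prod.snd_add, Prod.smul_fst, Prod.fst_sub,
      contractExtDeriv_smul, contractExtDeriv_sub, ← smul_add]
    congr 1
    exact add_sub_add_comm _ _ _ _

theorem pairing_twist (α : ∀ x : M, Cotangent n x) (x : M) (u v : GTangent n x) :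
    pairing x (twist α x u) (twist α x v) = pairing x u v := by
  simp only [pairing_apply, twist, add_apply, contractExtDeriv_swap α x v.1 u.1]
  ring

theorem twist_add (α : ∀ x : M, Cotangent n x) (x : M) (u v : GTangent n x) :
    twist α x (u + v) = twist α x u + twist α x v := by
  refine Prod.ext rfl ?_
  simp only [twist, Prod.snd_add, Prod.fst_add, contractExtDeriv_add]
  abel

end Twist

/-! ### Lifts and projections under the transformation. -/

namespace GeneralizedMetric

variable {n : ℕ} {M : Type*} [TopologicalSpace M] [ChartedSpace (Model n) M]
  [IsManifold (𝓡 n) ∞ M]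

theorem liftPlus_eq (G : GeneralizedMetric n M) (X : ∀ x : M, Tangent n x) {x : M}
    {u : GTangent n x} (hu : u ∈ G.plus x) (h : u.1 = X x) : G.liftPlus X x = u := by
  have : (LinearEquiv.ofBijective _ (G.bijective_plus x)).symm (X x) = ⟨u, hu⟩ := by
    rw [LinearEquiv.symm_apply_eq]
    exact h.symm
  rw [liftPlus, this]

theorem liftMinus_eq (G : GeneralizedMetric n M) (X : ∀ x : M, Tangent n x) {x : M}
    {u : GTangent n x} (hu : u ∈ G.minus x) (h : u.1 = X x) : G.liftMinus X x = u := by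
  have : (LinearEquiv.ofBijective _ (G.bijective_minus x)).symm (X x) = ⟨u, hu⟩ := by
    rw [LinearEquiv.symm_apply_eq]
    exact h.symm
  rw [liftMinus, this]

theorem projPlus_add (G : GeneralizedMetric n M) {x : M} {u v : GTangent n x}
    (hu : u ∈ G.plus x) (hv : v ∈ G.minus x) : (G.projPlus x (u + v) : GTangent n x) = u := by
  rw [map_add]
  have h1 : G.projPlus x u = ⟨u, hu⟩ :=
    Submodule.projectionOnto_apply_left (G.isCompl x) ⟨u, hu⟩
  have h2 : G.projPlus x v = 0 := Submodule.projectionOnto_apply_right (G.isCompl x) ⟨v, hv⟩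
  rw [h1, h2, add_zero]

/-- Every element of `W⁺` is a twist of one of `V⁺`, and `twist` preserves the pairing, so
orthogonality is inherited. -/
theorem twist_mem_minus {V W : GeneralizedMetric n M} {α : ∀ x : M, Cotangent n x} {x : M}
    (h : (W.plus x : Set (GTangent n x)) = twist α x '' V.plus x) {u : GTangent n x}
    (hu : u ∈ V.minus x) : twist α x u ∈ W.minus x := by
  intro w hw
  obtain ⟨v, hv, rfl⟩ := h.le hw
  exact (pairing_twist α x v u).trans (hu v hv)

theorem projPlus_twist {V W : GeneralizedMetric n M} {α : ∀ x : M, Cotangent n x} {x : M}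
    (h : (W.plus x : Set (GTangent n x)) = twist α x '' V.plus x) (u : GTangent n x) :
    (W.projPlus x (twist α x u) : GTangent n x) = twist α x (V.projPlus x u) := by
  obtain ⟨v, hv, w, hw, rfl⟩ := Submodule.mem_sup.1
    ((V.isCompl x).sup_eq_top ▸ Submodule.mem_top : u ∈ V.plus x ⊔ V.minus x)
  rw [twist_add, V.projPlus_add hv hw,
    W.projPlus_add (h.ge ⟨v, hv, rfl⟩) (twist_mem_minus h hw)]

/-- The elements `X - gX + bX` are orthogonal to the graph of `g + b`. -/
theorem mem_minus_of_graph (g : RiemannianMetric n M) (b : TwoForm n M)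
    {V : GeneralizedMetric n M} {x : M}
    (hV : (V.plus x : Set (GTangent n x)) =
      range fun X : Tangent n x ↦ (X, g.inner x X + b.toFun x X)) (X : Tangent n x) :
    ((X, -g.inner x X + b.toFun x X) : GTangent n x) ∈ V.minus x := by
  intro w hw
  obtain ⟨Y, rfl⟩ := hV.le hw
  -- Polarization of the alternating condition at `X + Y`.
  have hb : b.toFun x X Y + b.toFun x Y X = 0 := by
    have h := b.alternating x (X + Y)
    simpa [b.alternating] using h
  have hg : g.inner x X Y = g.inner x Y X := g.symm x X Y
  change (-g.inner x X + b.toFun x X) Y + (g.inner x Y + b.toFun x Y) X = 0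
  change -g.inner x X Y + b.toFun x X Y + (g.inner x Y X + b.toFun x Y X) = 0
  linarith

end GeneralizedMetric

end GeneralizedGeometry

theorem mainTheorem4 {n : ℕ} {M : Type*} [TopologicalSpace M]
    [ChartedSpace (GeneralizedGeometry.Model n) M] [IsManifold (𝓡 n) ∞ M]
    (g : GeneralizedGeometry.RiemannianMetric n M) (b : GeneralizedGeometry.TwoForm n M)
    (α : GeneralizedGeometry.OneForm n M) (V W : GeneralizedGeometry.GeneralizedMetric n M)
    (hV : ∀ x : M, (V.plus x : Set (GeneralizedGeometry.GTangent n x)) =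
      Set.range fun X : GeneralizedGeometry.Tangent n x ↦ (X, g.inner x X + b.toFun x X))
    (hW : ∀ x : M, (W.plus x : Set (GeneralizedGeometry.GTangent n x)) =
      Set.range fun X : GeneralizedGeometry.Tangent n x ↦
        (X, g.inner x X + b.toFun x X + GeneralizedGeometry.contractExtDeriv α.toFun x X)) :
    ∀ (X Y : GeneralizedGeometry.SmoothField n M) (x : M),
      V.connection X Y x = W.connection X Y x := by
  intro X Y x
  have hVW : ∀ x : M, (W.plus x : Set (GeneralizedGeometry.GTangent n x)) =
      GeneralizedGeometry.twist α.toFun x '' V.plus x := by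
    intro x
    rw [hW, hV, ← range_comp]
    rfl
  -- The explicit lifts `Y⁺ = Y + gY + bY` and `X⁻ = X - gX + bX` provide the smoothness that
  -- `courant_twist` requires.
  have hplus : ∀ y, (Y.toFun y, g.inner y (Y.toFun y) + b.toFun y (Y.toFun y)) ∈ V.plus y :=
    fun y ↦ (hV y).ge ⟨Y.toFun y, rfl⟩
  have hminus := fun y ↦
    GeneralizedGeometry.GeneralizedMetric.mem_minus_of_graph g b (hV y) (X.toFun y)
  have h1 : V.liftPlus Y.toFun = _ := funext fun y ↦ V.liftPlus_eq Y.toFun (hplus y) rfl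
  have h2 : V.liftMinus X.toFun = _ := funext fun y ↦ V.liftMinus_eq X.toFun (hminus y) rfl
  -- The lifts for `W` are the twisted lifts for `V`, by uniqueness of a lift with given tangent
  -- part.
  have h3 : W.liftPlus Y.toFun = _ := funext fun y ↦ W.liftPlus_eq Y.toFun
    ((hVW y).ge (mem_image_of_mem (GeneralizedGeometry.twist α.toFun y) (hplus y))) rfl
  have h4 : W.liftMinus X.toFun = _ := funext fun y ↦ W.liftMinus_eq X.toFun
    (GeneralizedGeometry.GeneralizedMetric.twist_mem_minus (hVW y) (hminus y)) rfl
  rw [GeneralizedGeometry.GeneralizedMetric.connection,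
    GeneralizedGeometry.GeneralizedMetric.connection, h1, h2, h3, h4,
    GeneralizedGeometry.courant_twist α.smooth X.smooth Y.smooth
      ((GeneralizedGeometry.smoothCovectorOn_metric g X).neg.add
        (GeneralizedGeometry.smoothCovectorOn_contract b X))
      ((GeneralizedGeometry.smoothCovectorOn_metric g Y).add
        (GeneralizedGeometry.smoothCovectorOn_contract b Y)),
    GeneralizedGeometry.GeneralizedMetric.projPlus_twist (hVW x)]
  -- `twist` leaves the tangent component unchanged.
  rfl
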